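/- Let $N\ge 1$ and $\beta\ge 0$. For $\mathbf a=(a_1,\dots,a_N)$ with all $a_j>0$ let $\Omega(\mathbf a)=(-a_1,a_1)\times\cdots\times(-a_N,a_N)\subset\mathbb R^N$ be the box with half-sides $a_j$. A real number $\lambda$ is called a Robin eigenvalue of $\Omega=\Omega(\mathbf a)$ with parameter $\beta$ if there is a real function $u\in C^2(\Omega)\cap C^1(\overline\Omega)$, not identically zero in $\Omega$, such that $$\Delta u+\lambda u=0\ \text{ in }\Omega,\qquad \beta\,\frac{\partial u}{\partial n}+u=0\ \text{ on }\partial\Omega,$$ where $n$ is the outward unit normal (the boundary condition being imposed at the points in the relative interiors of the faces, where $n$ is defined). Then every box $\Omega(\mathbf a)$ has a smallest Robin eigenvalue $\lambda_1(\Omega(\mathbf a))$, its fundamental Robin eigenvalue, and among all boxes of a given volume the cube, and only the cube, has the smallest fundamental Robin eigenvalue: if $h>0$ and $|\Omega(\mathbf a)|=|\Omega(h,\dots,h)|=(2h)^N$, then $$\lambda_1(\Omega(h,\dots,h))\le\lambda_1(\Omega(\mathbf a)),$$ with equality if and only if $a_1=\cdots=a_N=h$. -/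

import Mathlib

open MeasureTheory

/-- The open box `(-a₁, a₁) × ⋯ × (-a_N, a_N)` in `N`-dimensional Euclidean space. -/
def box {N : ℕ} (a : Fin N → ℝ) : Set (EuclideanSpace ℝ (Fin N)) :=
  {x | ∀ j, x j ∈ Set.Ioo (-a j) (a j)}

/-- The pair `(x, n)` consists of a point `x` in the relative interior of a face of the box with
half-sides `a`, and the outward unit normal `n` of the box at `x`. These are precisely the
boundary points at which the outward normal is defined. -/
def IsOutwardNormalAt {N : ℕ} (a : Fin N → ℝ) (x n : EuclideanSpace ℝ (Fin N)) : Prop :=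
  ∃ i : Fin N, (∀ j, j ≠ i → x j ∈ Set.Ioo (-a j) (a j)) ∧
    ((x i = a i ∧ n = EuclideanSpace.single i (1 : ℝ)) ∨
      (x i = -a i ∧ n = EuclideanSpace.single i (-1 : ℝ)))

/-- `u` is a classical eigenfunction, with eigenvalue `l`, of the Robin problem
`Δ u + l u = 0` in `Ω`, `β ∂u/∂n + u = 0` on `∂Ω`, where `Ω` is the box with half-sides `a`:
`u` belongs to `C²(Ω) ∩ C¹(Ω̄)` and is not identically zero in `Ω`. On the boundary, the
derivative of `u` is its derivative within the closed box. -/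
structure IsRobinEigenfunction {N : ℕ} (β : ℝ) (a : Fin N → ℝ) (l : ℝ)
    (u : EuclideanSpace ℝ (Fin N) → ℝ) : Prop where
  contDiffOn_box : ContDiffOn ℝ 2 u (box a)
  contDiffOn_closure : ContDiffOn ℝ 1 u (closure (box a))
  ne_zero : ∃ x ∈ box a, u x ≠ 0
  helmholtz : ∀ x ∈ box a, Laplacian.laplacian u x + l * u x = 0
  robin : ∀ x n, IsOutwardNormalAt a x n →
    β * fderivWithin ℝ u (closure (box a)) x n + u x = 0

/-- The set of Robin eigenvalues of the Laplacian on the box with half-sides `a`. -/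
def robinEigenvalues {N : ℕ} (β : ℝ) (a : Fin N → ℝ) : Set ℝ :=
  {l | ∃ u, IsRobinEigenfunction β a l u}

/-- The fundamental (that is, smallest) Robin eigenvalue of the box with half-sides `a`. -/
noncomputable def fundamentalRobinEigenvalue {N : ℕ} (β : ℝ) (a : Fin N → ℝ) : ℝ :=
  sInf (robinEigenvalues β a)

/-!
The fundamental eigenvalue of the box is found by separation of variables. The interval `(-a, a)`
has the even solution `cos (k x)`, whose Robin condition is `cos (k a) = β k sin (k a)`; the least
positive root `k = k(a)` is the solution of `k a = arccot (β k)` (`IsRobinFrequency`), and the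
product of these cosines is an eigenfunction of the box with eigenvalue `∑ⱼ k(aⱼ)²`.

No eigenvalue is smaller (`IsRobinEigenfunction.sum_sq_le_of_supersolution`). With frequencies
`kⱼ < k(aⱼ)` the product `U` of cosines is positive on the closed box and satisfies
`β ∂U/∂n + U > 0` on the boundary. If `u` is an eigenfunction with eigenvalue `l < ∑ⱼ kⱼ²`, positive
somewhere, and `M > 0` is the maximum of `u / U`, attained at `x`, then `M U - u ≥ 0` vanishes at
`x`. At an interior point its Laplacian is negative there, and at a boundary point its outward
derivative is positive; neither is possible at a minimum. Edges and corners need no separate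
argument, since `u` is `C¹` up to the boundary and so satisfies the Robin condition of each face on
the closed face. Letting `kⱼ` increase to `k(aⱼ)` gives the bound (`isLeast_robinEigenvalues`).

The volume fixes `∑ⱼ log aⱼ`, so the isoperimetric inequality and its equality case follow from the
strict convexity of `k(a)²` as a function of `log a`, in the form of a tangent-line inequality
(`sq_add_log_lt`). The curve is explicit when parametrized by `k`, namely
`log a = log (arccot (β k)) - log k`, and convexity becomes the strict monotonicity of
`k² / (1 + S(k))`, where `1 + S = -d log a / d log k` (`sq_mul_one_add_robinSlope_lt`). It rests on
the monotonicity of `t arccot t`, that is, on `sin θ cos θ < θ`.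
-/

/-! ### The Laplacian and second derivatives along coordinate lines -/

theorem deriv_deriv_comp_line {E : Type*} [NormedAddCommGroup E] [NormedSpace ℝ E]
    {f : E → ℝ} {x : E} (hf : ContDiffAt ℝ 2 f x) (v : E) :
    deriv (deriv fun t : ℝ => f (x + t • v)) 0 = iteratedFDeriv ℝ 2 f x ![v, v] := by
  have hline (t : ℝ) : HasDerivAt (fun t : ℝ => x + t • v) v t := by
    simpa using ((hasDerivAt_id t).smul_const v).const_add x
  have hx0 : x + (0 : ℝ) • v = x := by simp
  have hd : ∀ᶠ y in nhds x, DifferentiableAt ℝ f y := by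
    filter_upwards [hf.eventually (by simp)] with y hy
    exact hy.differentiableAt (by simp)
  have hev : deriv (fun t : ℝ => f (x + t • v)) =ᶠ[nhds 0]
      fun t => fderiv ℝ f (x + t • v) v := by
    have hc : Filter.Tendsto (fun t : ℝ => x + t • v) (nhds 0) (nhds x) := by
      simpa using (hline 0).continuousAt.tendsto
    filter_upwards [hc.eventually hd] with t ht
    exact (ht.hasFDerivAt.comp_hasDerivAt t (hline t)).deriv
  rw [hev.deriv_eq, iteratedFDeriv_two_apply]
  have h1 : ContDiffAt ℝ 1 (fderiv ℝ f) x := hf.fderiv_right (by norm_num)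
  have h2 : HasFDerivAt (fderiv ℝ f) (fderiv ℝ (fderiv ℝ f) x) (x + (0 : ℝ) • v) := by
    rw [hx0]
    exact (h1.differentiableAt one_ne_zero).hasFDerivAt
  have h3 : HasDerivAt (fun t : ℝ => fderiv ℝ f (x + t • v)) (fderiv ℝ (fderiv ℝ f) x v) 0 :=
    h2.comp_hasDerivAt (0 : ℝ) (hline 0)
  have h4 := h3.clm_apply (hasDerivAt_const (0 : ℝ) v)
  rw [h4.deriv]
  simp

theorem IsLocalMin.deriv_deriv_nonneg {g : ℝ → ℝ} {t : ℝ} (h : IsLocalMin g t)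
    (hc : ContinuousAt g t) : 0 ≤ deriv (deriv g) t := by
  by_contra! hneg
  -- Otherwise `t` is also a local maximum, and `g` is constant near `t`.
  have hmax := isLocalMax_of_deriv_deriv_neg hneg h.deriv_eq_zero hc
  have hconst : g =ᶠ[nhds t] fun _ => g t := by
    filter_upwards [h, hmax] with s h1 h2
    exact le_antisymm h2 h1
  have h0 : deriv g =ᶠ[nhds t] fun _ => 0 := by
    simpa using hconst.deriv
  simp [h0.deriv_eq] at hneg

theorem laplacian_eq_sum_deriv_deriv {N : ℕ} {f : EuclideanSpace ℝ (Fin N) → ℝ}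
    {x : EuclideanSpace ℝ (Fin N)} (hf : ContDiffAt ℝ 2 f x) :
    Laplacian.laplacian f x =
      ∑ i, deriv (deriv fun t : ℝ => f (x + t • EuclideanSpace.single i (1 : ℝ))) 0 := by
  rw [InnerProductSpace.laplacian_eq_iteratedFDeriv_orthonormalBasis f
    (EuclideanSpace.basisFun (Fin N) ℝ)]
  exact Finset.sum_congr rfl fun i _ => by simp [deriv_deriv_comp_line hf]

theorem IsLocalMin.laplacian_nonneg {N : ℕ} {f : EuclideanSpace ℝ (Fin N) → ℝ}
    {x : EuclideanSpace ℝ (Fin N)} (h : IsLocalMin f x) (hf : ContDiffAt ℝ 2 f x) :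
    0 ≤ Laplacian.laplacian f x := by
  rw [laplacian_eq_sum_deriv_deriv hf]
  refine Finset.sum_nonneg fun i _ => ?_
  set v := EuclideanSpace.single i (1 : ℝ)
  have hl : Continuous fun t : ℝ => x + t • v := by fun_prop
  have hx0 : x + (0 : ℝ) • v = x := by simp
  refine IsLocalMin.deriv_deriv_nonneg ?_ ?_
  · have := hl.tendsto 0
    simp only [hx0] at this
    filter_upwards [this.eventually h] with t ht
    simpa using ht
  · refine ContinuousAt.comp (f := fun t : ℝ => x + t • v) (g := f) ?_ hl.continuousAt
    rw [hx0]
    exact hf.continuousAt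

/-! ### Boxes -/

theorem box_eq_preimage {N : ℕ} (a : Fin N → ℝ) :
    box a = EuclideanSpace.equiv (Fin N) ℝ ⁻¹' Set.univ.pi fun j => Set.Ioo (-a j) (a j) := by
  ext x
  simp [box]

theorem isOpen_box {N : ℕ} (a : Fin N → ℝ) : IsOpen (box a) := by
  rw [box_eq_preimage]
  exact (isOpen_set_pi Set.finite_univ fun _ _ => isOpen_Ioo).preimage
    (EuclideanSpace.equiv (Fin N) ℝ).continuous

theorem convex_box {N : ℕ} (a : Fin N → ℝ) : Convex ℝ (box a) := by
  rw [box_eq_preimage]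
  exact (convex_pi fun _ _ => convex_Ioo _ _).linear_preimage
    (EuclideanSpace.equiv (Fin N) ℝ).toLinearMap

theorem zero_mem_box {N : ℕ} {a : Fin N → ℝ} (ha : ∀ j, 0 < a j) : 0 ∈ box a := by
  intro j
  simp [ha j]

theorem closure_box {N : ℕ} {a : Fin N → ℝ} (ha : ∀ j, 0 < a j) :
    closure (box a) = {x | ∀ j, x j ∈ Set.Icc (-a j) (a j)} := by
  rw [box_eq_preimage]
  have := (EuclideanSpace.equiv (Fin N) ℝ).toHomeomorph.preimage_closure
    (Set.univ.pi fun j => Set.Ioo (-a j) (a j))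
  simp only [ContinuousLinearEquiv.coe_toHomeomorph] at this
  rw [← this, closure_pi_set]
  ext x
  have (j : Fin N) : closure (Set.Ioo (-a j) (a j)) = Set.Icc (-a j) (a j) :=
    closure_Ioo (by linarith [ha j])
  simp only [this]
  simp [-Set.pi_univ_Icc, Set.mem_pi]

theorem IsOutwardNormalAt.mem_closure_box {N : ℕ} {a : Fin N → ℝ} (ha : ∀ j, 0 < a j)
    {x n : EuclideanSpace ℝ (Fin N)} (h : IsOutwardNormalAt a x n) : x ∈ closure (box a) := by
  obtain ⟨i, hj, hi⟩ := h
  rw [closure_box ha]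
  intro j
  by_cases hji : j = i
  · subst hji
    have := ha j
    rcases hi with ⟨h, -⟩ | ⟨h, -⟩ <;> rw [h] <;> constructor <;> linarith
  · exact Set.Ioo_subset_Icc_self (hj j hji)

theorem isCompact_closure_box {N : ℕ} {a : Fin N → ℝ} (ha : ∀ j, 0 < a j) :
    IsCompact (closure (box a)) := by
  have h : closure (box a) = (EuclideanSpace.equiv (Fin N) ℝ).toHomeomorph ⁻¹'
      Set.univ.pi fun j => Set.Icc (-a j) (a j) := by
    rw [closure_box ha]
    ext x
    simp [-Set.pi_univ_Icc, Set.mem_pi]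
  rw [h, Homeomorph.isCompact_preimage]
  exact isCompact_univ_pi fun _ => isCompact_Icc

theorem uniqueDiffOn_closure_box {N : ℕ} {a : Fin N → ℝ} (ha : ∀ j, 0 < a j) :
    UniqueDiffOn ℝ (closure (box a)) :=
  uniqueDiffOn_convex (convex_box a).closure
    ⟨0, interior_mono subset_closure ((isOpen_box a).interior_eq.symm ▸ zero_mem_box ha)⟩

theorem volume_box {N : ℕ} {a : Fin N → ℝ} (ha : ∀ j, 0 < a j) :
    volume (box a) = ENNReal.ofReal (∏ j, (2 * a j)) := by
  have h := (PiLp.volume_preserving_ofLp (Fin N)).measure_preimage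
    (s := Set.univ.pi fun j => Set.Ioo (-a j) (a j))
    (MeasurableSet.univ_pi fun _ => measurableSet_Ioo).nullMeasurableSet
  rw [Real.volume_pi_Ioo] at h
  rw [box_eq_preimage]
  refine Eq.trans h ?_
  rw [ENNReal.ofReal_prod_of_nonneg fun j _ => by linarith [ha j]]
  exact Finset.prod_congr rfl fun j _ => by rw [sub_neg_eq_add, two_mul]

/-- At a corner, several faces meet and no outward normal exists, but continuity of `u` and of
its derivative up to the boundary gives the Robin condition of every face at all points of that
closed face. -/
theorem IsRobinEigenfunction.robin_of_mem_closed_face {N : ℕ} {β l : ℝ} {a : Fin N → ℝ}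
    (ha : ∀ j, 0 < a j) {u : EuclideanSpace ℝ (Fin N) → ℝ} (hu : IsRobinEigenfunction β a l u)
    {x : EuclideanSpace ℝ (Fin N)} (hx : x ∈ closure (box a)) {i : Fin N} {s : ℝ}
    (hs : s = 1 ∨ s = -1) (hxi : x i = s * a i) :
    β * fderivWithin ℝ u (closure (box a)) x (EuclideanSpace.single i s) + u x = 0 := by
  set n := EuclideanSpace.single i s with hn
  -- The points `y t`, `t ↓ 0`, of the open face approach `x` on the segment from its centre.
  set y : ℝ → EuclideanSpace ℝ (Fin N) := fun t => x + t • (a i • n - x) with hy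
  have hx' := hx
  rw [closure_box ha] at hx'
  have hyi (t : ℝ) : y t i = s * a i := by
    simp [hy, hn, hxi, mul_comm (a i) s]
  have hyj (t : ℝ) (j : Fin N) (hj : j ≠ i) : y t j = (1 - t) * x j := by
    simp [hy, hn, hj]; ring
  have hface : ∀ t ∈ Set.Ioo (0 : ℝ) 1, IsOutwardNormalAt a (y t) n := by
    intro t ht
    refine ⟨i, fun j hj => ?_, ?_⟩
    · rw [hyj t j hj]
      have h1 := (hx' j).1
      have h2 := (hx' j).2
      constructor <;> nlinarith [ht.1, ht.2, ha j]
    · rw [hyi]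
      rcases hs with rfl | rfl <;> simp [hn]
  have hmem : ∀ t ∈ Set.Ioo (0 : ℝ) 1, y t ∈ closure (box a) := fun t ht =>
    (hface t ht).mem_closure_box ha
  have hcont : ContinuousOn
      (fun z => β * fderivWithin ℝ u (closure (box a)) z n + u z) (closure (box a)) :=
    ((((hu.contDiffOn_closure.continuousOn_fderivWithin (uniqueDiffOn_closure_box ha)
      le_rfl).clm_apply continuousOn_const).const_smul β).add hu.contDiffOn_closure.continuousOn)
  have hIoo : Set.Ioo (0 : ℝ) 1 ∈ nhdsWithin (0 : ℝ) (Set.Ioi 0) := Ioo_mem_nhdsGT one_pos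
  have hyt : Filter.Tendsto y (nhdsWithin 0 (Set.Ioi 0)) (nhdsWithin x (closure (box a))) := by
    refine tendsto_nhdsWithin_iff.2 ⟨?_, Filter.mem_of_superset hIoo hmem⟩
    have hyc : Continuous y := by fun_prop
    simpa [hy] using (hyc.tendsto 0).mono_left nhdsWithin_le_nhds
  refine tendsto_nhds_unique ((hcont x hx).tendsto.comp hyt) ?_
  refine tendsto_const_nhds.congr' ?_
  filter_upwards [hIoo] with t ht
  exact (hu.robin _ _ (hface t ht)).symm

/-! ### Products of cosines -/

/-- The product of cosines `x ↦ ∏ⱼ cos (kⱼ xⱼ)`, the separated solution of the Helmholtz equation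
that is even in each variable. -/
noncomputable def cosProd {N : ℕ} (k : Fin N → ℝ) (x : EuclideanSpace ℝ (Fin N)) : ℝ :=
  ∏ j, Real.cos (k j * x j)

theorem contDiff_cosProd {N : ℕ} (k : Fin N → ℝ) {n : WithTop ℕ∞} :
    ContDiff ℝ n (cosProd k) := by
  unfold cosProd
  fun_prop

theorem cosProd_line {N : ℕ} (k : Fin N → ℝ) (x : EuclideanSpace ℝ (Fin N)) (i : Fin N)
    (s t : ℝ) :
    cosProd k (x + t • EuclideanSpace.single i s) =
      Real.cos (k i * (x i + t * s)) * ∏ j ∈ Finset.univ.erase i, Real.cos (k j * x j) := by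
  rw [cosProd, ← Finset.mul_prod_erase _ _ (Finset.mem_univ i)]
  congr 1
  · simp
  · refine Finset.prod_congr rfl fun j hj => ?_
    simp [Finset.ne_of_mem_erase hj]

theorem cosProd_eq_mul_erase {N : ℕ} (k : Fin N → ℝ) (x : EuclideanSpace ℝ (Fin N)) (i : Fin N) :
    cosProd k x =
      Real.cos (k i * x i) * ∏ j ∈ Finset.univ.erase i, Real.cos (k j * x j) := by
  simpa using cosProd_line k x i 0 0

theorem fderiv_cosProd_single {N : ℕ} (k : Fin N → ℝ) (x : EuclideanSpace ℝ (Fin N)) (i : Fin N)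
    (s : ℝ) :
    fderiv ℝ (cosProd k) x (EuclideanSpace.single i s) =
      -Real.sin (k i * x i) * (k i * s) *
        ∏ j ∈ Finset.univ.erase i, Real.cos (k j * x j) := by
  have hd : HasFDerivAt (cosProd k) (fderiv ℝ (cosProd k) x)
      (x + (0 : ℝ) • EuclideanSpace.single i s) := by
    simpa using ((contDiff_cosProd k (n := 1)).differentiable one_ne_zero x).hasFDerivAt
  have hline : HasDerivAt (fun t : ℝ => x + t • EuclideanSpace.single i s)
      (EuclideanSpace.single i s) 0 := by
    simpa using ((hasDerivAt_id (0 : ℝ)).smul_const (EuclideanSpace.single i s)).const_add x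
  have h1 := hd.comp_hasDerivAt (0 : ℝ) hline
  have h2 : HasDerivAt (fun t : ℝ => k i * (x i + t * s)) (k i * s) 0 := by
    simpa using (((hasDerivAt_id (0 : ℝ)).mul_const s).const_add (x i)).const_mul (k i)
  have h3 := h2.cos.mul_const (∏ j ∈ Finset.univ.erase i, Real.cos (k j * x j))
  have h4 : (cosProd k ∘ fun t : ℝ => x + t • EuclideanSpace.single i s) =
      fun t => Real.cos (k i * (x i + t * s)) *
        ∏ j ∈ Finset.univ.erase i, Real.cos (k j * x j) :=
    funext fun t => cosProd_line k x i s t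
  rw [h4] at h1
  simpa using h1.unique h3

theorem laplacian_cosProd {N : ℕ} (k : Fin N → ℝ) (x : EuclideanSpace ℝ (Fin N)) :
    Laplacian.laplacian (cosProd k) x = -(∑ j, k j ^ 2) * cosProd k x := by
  rw [laplacian_eq_sum_deriv_deriv (contDiff_cosProd k).contDiffAt, neg_mul, Finset.sum_mul,
    ← Finset.sum_neg_distrib]
  refine Finset.sum_congr rfl fun i _ => ?_
  simp only [cosProd_line, mul_one]
  set P := ∏ j ∈ Finset.univ.erase i, Real.cos (k j * x j) with hP
  have hl (t : ℝ) : HasDerivAt (fun t : ℝ => k i * (x i + t)) (k i) t := by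
    simpa using ((hasDerivAt_id t).const_add (x i)).const_mul (k i)
  have h1 : deriv (fun t : ℝ => Real.cos (k i * (x i + t)) * P) =
      fun t => -Real.sin (k i * (x i + t)) * k i * P :=
    funext fun t => ((hl t).cos.mul_const P).deriv
  have h2 : HasDerivAt (fun t : ℝ => -Real.sin (k i * (x i + t)) * k i * P)
      (-(Real.cos (k i * (x i + 0)) * k i) * k i * P) 0 :=
    (((hl 0).sin.neg).mul_const (k i)).mul_const P
  rw [h1, h2.deriv, cosProd_eq_mul_erase k x i, ← hP, add_zero]
  ring

theorem cosProd_isRobinEigenfunction {N : ℕ} {β : ℝ} {a k : Fin N → ℝ} (ha : ∀ j, 0 < a j)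
    (hk : ∀ j, Real.cos (k j * a j) = β * (k j * Real.sin (k j * a j))) :
    IsRobinEigenfunction β a (∑ j, k j ^ 2) (cosProd k) where
  contDiffOn_box := (contDiff_cosProd k).contDiffOn
  contDiffOn_closure := (contDiff_cosProd k).contDiffOn
  ne_zero := ⟨0, zero_mem_box ha, by simp [cosProd]⟩
  helmholtz x _ := by rw [laplacian_cosProd]; ring
  robin := by
    intro x n hn
    have hx := hn.mem_closure_box ha
    obtain ⟨i, -, hi⟩ := hn
    rw [((contDiff_cosProd k (n := 1)).differentiable one_ne_zero x).fderivWithin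
      (uniqueDiffOn_closure_box ha x hx), cosProd_eq_mul_erase k x i]
    rcases hi with ⟨h, rfl⟩ | ⟨h, rfl⟩
    · rw [fderiv_cosProd_single, h, hk i]
      ring
    · rw [fderiv_cosProd_single, h, mul_neg, Real.sin_neg, Real.cos_neg, hk i]
      ring

/-! ### A lower bound for Robin eigenvalues -/

theorem IsRobinEigenfunction.neg {N : ℕ} {β l : ℝ} {a : Fin N → ℝ}
    (ha : ∀ j, 0 < a j) {u : EuclideanSpace ℝ (Fin N) → ℝ}
    (hu : IsRobinEigenfunction β a l u) : IsRobinEigenfunction β a l (-u) where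
  contDiffOn_box := hu.contDiffOn_box.neg
  contDiffOn_closure := hu.contDiffOn_closure.neg
  ne_zero := by
    obtain ⟨x, hx, h⟩ := hu.ne_zero
    exact ⟨x, hx, by simpa using h⟩
  helmholtz x hx := by
    have h := hu.helmholtz x hx
    have h1 : Laplacian.laplacian (-u) x = -Laplacian.laplacian u x :=
      congrFun (InnerProductSpace.laplacian_neg (f := u)) x
    simp only [h1, Pi.neg_apply]
    linarith
  robin x n hn := by
    have h := hu.robin x n hn
    have hx : fderivWithin ℝ (-u) (closure (box a)) x n =
        -fderivWithin ℝ u (closure (box a)) x n := by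
      rw [fderivWithin_neg (uniqueDiffOn_closure_box ha x (hn.mem_closure_box ha))]
      rfl
    rw [hx, Pi.neg_apply]
    linarith

/-- The lower bound for Robin eigenvalues given by a positive strict supersolution: if
`cos (kⱼ aⱼ) > β kⱼ sin (kⱼ aⱼ)` for all `j`, the product of cosines with frequencies `kⱼ` satisfies
`β ∂U/∂n + U > 0` on the boundary, and no eigenvalue is below `∑ⱼ kⱼ²`. -/
theorem IsRobinEigenfunction.sum_sq_le_of_supersolution {N : ℕ} {β l : ℝ} (hβ : 0 ≤ β)
    {a k : Fin N → ℝ} (ha : ∀ j, 0 < a j) (hk : ∀ j, 0 < k j)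
    (hka : ∀ j, k j * a j < Real.pi / 2)
    (hsuper : ∀ j, β * (k j * Real.sin (k j * a j)) < Real.cos (k j * a j))
    {u : EuclideanSpace ℝ (Fin N) → ℝ} (hu : IsRobinEigenfunction β a l u) :
    ∑ j, k j ^ 2 ≤ l := by
  by_contra! hlt
  wlog hpos : ∃ x ∈ box a, 0 < u x generalizing u
  · obtain ⟨x, hx, hne⟩ := hu.ne_zero
    refine this (hu.neg ha) ⟨x, hx, ?_⟩
    have hle : u x ≤ 0 := by
      by_contra! h
      exact hpos ⟨x, hx, h⟩
    simpa using lt_of_le_of_ne hle hne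
  obtain ⟨z, hz, huz⟩ := hpos
  set K := closure (box a) with hK
  set U := cosProd k
  have hcos : ∀ x ∈ K, ∀ j, 0 < Real.cos (k j * x j) := by
    intro x hx j
    rw [hK, closure_box ha] at hx
    have h1 := mul_le_mul_of_nonneg_left (hx j).1 (hk j).le
    have h2 := mul_le_mul_of_nonneg_left (hx j).2 (hk j).le
    have h3 := hka j
    exact Real.cos_pos_of_mem_Ioo ⟨by linarith, by linarith⟩
  have hU : ∀ x ∈ K, 0 < U x := fun x hx => Finset.prod_pos fun j _ => hcos x hx j
  have hUc : ContDiff ℝ 2 U := contDiff_cosProd k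
  have hzK : z ∈ K := subset_closure hz
  obtain ⟨x, hxK, hxmax⟩ := (isCompact_closure_box ha).exists_isMaxOn ⟨z, hzK⟩
    (hu.contDiffOn_closure.continuousOn.div hUc.continuous.continuousOn fun y hy => (hU y hy).ne')
  set M := u x / U x with hM
  have hM0 : 0 < M := (div_pos huz (hU z hzK)).trans_le (hxmax hzK)
  -- `g = M U - u` is nonnegative on the closed box and vanishes at `x`.
  set g : EuclideanSpace ℝ (Fin N) → ℝ := M • U - u with hg
  have hux : u x = M * U x := by rw [hM, div_mul_cancel₀ _ (hU x hxK).ne']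
  have hgx : g x = 0 := by simp [hg, hux]
  have hgmin : ∀ y ∈ K, 0 ≤ g y := by
    intro y hy
    have h : u y / U y ≤ M := hxmax hy
    rw [div_le_iff₀ (hU y hy)] at h
    simp only [hg, Pi.sub_apply, Pi.smul_apply, smul_eq_mul]
    linarith
  by_cases hxb : x ∈ box a
  · have hn : box a ∈ nhds x := (isOpen_box a).mem_nhds hxb
    have hloc : IsLocalMin g x := by
      filter_upwards [hn] with y hy
      rw [hgx]
      exact hgmin y (subset_closure hy)
    have hu2 : ContDiffAt ℝ 2 u x := hu.contDiffOn_box.contDiffAt hn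
    have hMU2 : ContDiffAt ℝ 2 (M • U) x := contDiffAt_const.smul hUc.contDiffAt
    have hlap := hloc.laplacian_nonneg (hMU2.sub hu2)
    rw [hMU2.laplacian_sub hu2, InnerProductSpace.laplacian_smul M hUc.contDiffAt,
      laplacian_cosProd, smul_eq_mul] at hlap
    have hh := hu.helmholtz x hxb
    rw [hux] at hh
    have hpos : 0 < M * U x := mul_pos hM0 (hU x hxK)
    have : Laplacian.laplacian u x = -(l * (M * U x)) := by linarith
    rw [this] at hlap
    change 0 ≤ M * (-(∑ j, k j ^ 2) * U x) - _ at hlap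
    nlinarith
  · have hxI : x ∈ closure (box a) := hxK
    rw [closure_box ha] at hxI
    obtain ⟨i, s, hs, hxi⟩ : ∃ i, ∃ s : ℝ, (s = 1 ∨ s = -1) ∧ x i = s * a i := by
      simp only [box, Set.mem_ofPred_eq, not_forall] at hxb
      obtain ⟨i, hi⟩ := hxb
      rcases eq_or_lt_of_le (hxI i).1 with h | h
      · exact ⟨i, -1, Or.inr rfl, by linarith⟩
      · exact ⟨i, 1, Or.inl rfl, by
          linarith [le_antisymm (hxI i).2 (not_lt.1 fun h' => hi ⟨h, h'⟩)]⟩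
    set n := EuclideanSpace.single i s with hn
    have hrob : β * fderivWithin ℝ u K x n + u x = 0 := hu.robin_of_mem_closed_face ha hxK hs hxi
    have hud : UniqueDiffWithinAt ℝ K x := uniqueDiffOn_closure_box ha x hxK
    have hUd : DifferentiableAt ℝ U x := hUc.differentiable two_ne_zero x
    have hdu : DifferentiableWithinAt ℝ u K x :=
      hu.contDiffOn_closure.differentiableOn one_ne_zero x hxK
    have hdg : fderivWithin ℝ g K x n = M * fderiv ℝ U x n - fderivWithin ℝ u K x n := by
      rw [hg, fderivWithin_sub hud (hUd.const_smul M).differentiableWithinAt hdu,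
        (hUd.const_smul M).fderivWithin hud, fderiv_const_smul hUd]
      simp
    have hUrob : 0 < β * fderiv ℝ U x n + U x := by
      have hP : 0 < ∏ j ∈ Finset.univ.erase i, Real.cos (k j * x j) :=
        Finset.prod_pos fun j _ => hcos x hxK j
      rw [hn, fderiv_cosProd_single, show U x = _ from cosProd_eq_mul_erase k x i, hxi]
      have := mul_pos (sub_pos.2 (hsuper i)) hP
      rcases hs with rfl | rfl
      · rw [one_mul]
        linarith
      · rw [neg_one_mul, mul_neg (k i), Real.sin_neg, Real.cos_neg]
        linarith
    -- `x - 2 aᵢ n` is the mirror image of `x` on the opposite face, so the segment stays in the box.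
    have hcone : -((2 * a i) • n) ∈ posTangentConeAt K x := by
      refine mem_posTangentConeAt_of_segment_subset ((convex_box a).closure.segment_subset hxK ?_)
      rw [closure_box ha]
      intro j
      by_cases hj : j = i
      · subst hj
        have := ha j
        rcases hs with rfl | rfl <;> simp [hn, hxi] <;> constructor <;> linarith
      · simpa [hn, hj] using hxI j
    have hmin : IsLocalMinOn g K x := by
      filter_upwards [self_mem_nhdsWithin] with y hy
      rw [hgx]
      exact hgmin y hy
    have hnn := hmin.fderivWithin_nonneg hcone
    rw [map_neg, map_smul, smul_eq_mul, hdg] at hnn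
    have h1 : M * fderiv ℝ U x n - fderivWithin ℝ u K x n ≤ 0 := by
      have := ha i
      by_contra! h
      nlinarith [mul_pos this h]
    have h2 := mul_nonneg hβ (neg_nonneg.2 h1)
    have h3 := mul_pos hM0 hUrob
    rw [hux] at hrob
    linarith

/-! ### The fundamental frequency of an interval -/

theorem pi_div_two_sub_arctan_pos (t : ℝ) : 0 < Real.pi / 2 - Real.arctan t :=
  sub_pos.2 (Real.arctan_lt_pi_div_two t)

/-- `t / (1 + t ^ 2) < π / 2 - arctan t` is `sin θ cos θ < θ` for `t = cot θ`. -/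
theorem div_one_add_sq_lt_pi_div_two_sub_arctan (t : ℝ) :
    t / (1 + t ^ 2) < Real.pi / 2 - Real.arctan t := by
  have h := Real.sin_lt (x := 2 * (Real.pi / 2 - Real.arctan t))
    (by linarith [pi_div_two_sub_arctan_pos t])
  rw [Real.sin_two_mul, Real.sin_pi_div_two_sub, Real.cos_pi_div_two_sub, Real.sin_arctan,
    Real.cos_arctan] at h
  have hs : Real.sqrt (1 + t ^ 2) * Real.sqrt (1 + t ^ 2) = 1 + t ^ 2 :=
    Real.mul_self_sqrt (by positivity)
  have h2 : 2 * (1 / Real.sqrt (1 + t ^ 2)) * (t / Real.sqrt (1 + t ^ 2)) =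
      2 * (t / (1 + t ^ 2)) := by
    rw [mul_assoc, div_mul_div_comm, one_mul, hs]
  linarith

theorem monotone_mul_pi_div_two_sub_arctan :
    Monotone fun t : ℝ => t * (Real.pi / 2 - Real.arctan t) := by
  have hd (t : ℝ) : HasDerivAt (fun t : ℝ => t * (Real.pi / 2 - Real.arctan t))
      (1 * (Real.pi / 2 - Real.arctan t) + t * -(1 / (1 + t ^ 2))) t :=
    (hasDerivAt_id t).mul ((Real.hasDerivAt_arctan t).const_sub (Real.pi / 2))
  refine monotone_of_deriv_nonneg (fun t => (hd t).differentiableAt) fun t => ?_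
  rw [(hd t).deriv]
  have := div_one_add_sq_lt_pi_div_two_sub_arctan t
  rw [div_eq_mul_one_div] at this
  linarith

/-- The fundamental frequency `k` of the interval `(-a, a)` is determined by
`k a = arccot (β k)`, a form of `cos (k a) = β k sin (k a)` that also covers `β = 0`. -/
def IsRobinFrequency (β a k : ℝ) : Prop :=
  0 < k ∧ k * a = Real.pi / 2 - Real.arctan (β * k)

theorem exists_isRobinFrequency {β a : ℝ} (hβ : 0 ≤ β) (ha : 0 < a) :
    ∃ k, IsRobinFrequency β a k := by
  have hb : 0 < Real.pi / (2 * a) := by positivity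
  have hc : ContinuousOn (fun k : ℝ => Real.pi / 2 - Real.arctan (β * k) - k * a)
      (Set.Icc 0 (Real.pi / (2 * a))) := by
    have := Real.continuous_arctan
    fun_prop
  have h := intermediate_value_Icc' hb.le hc
  have hmem : (0 : ℝ) ∈ Set.Icc
      (Real.pi / 2 - Real.arctan (β * (Real.pi / (2 * a))) - Real.pi / (2 * a) * a)
      (Real.pi / 2 - Real.arctan (β * 0) - 0 * a) := by
    have h1 : Real.pi / (2 * a) * a = Real.pi / 2 := by field_simp
    have h2 : 0 ≤ Real.arctan (β * (Real.pi / (2 * a))) := Real.arctan_nonneg.2 (by positivity)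
    constructor
    · rw [h1]; linarith
    · simpa using Real.pi_div_two_pos.le
  obtain ⟨k, hk, hk0⟩ := h hmem
  simp only at hk0
  have hka : k * a = Real.pi / 2 - Real.arctan (β * k) := by linarith
  refine ⟨k, hk.1.lt_of_ne ?_, hka⟩
  rintro rfl
  simp only [zero_mul, mul_zero, Real.arctan_zero, sub_zero] at hka
  exact Real.pi_div_two_pos.ne hka

namespace IsRobinFrequency

variable {β a k : ℝ}

theorem cos_eq (h : IsRobinFrequency β a k) :
    Real.cos (k * a) = β * (k * Real.sin (k * a)) := by
  rw [h.2, Real.cos_pi_div_two_sub, Real.sin_pi_div_two_sub, Real.sin_arctan, Real.cos_arctan]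
  ring

theorem mul_le_pi_div_two (h : IsRobinFrequency β a k) (hβ : 0 ≤ β) : k * a ≤ Real.pi / 2 := by
  have := Real.arctan_nonneg.2 (mul_nonneg hβ h.1.le)
  rw [h.2]
  linarith

/-- Lowering the fundamental frequency turns the Robin boundary equation into a strict
inequality. -/
theorem supersolution (h : IsRobinFrequency β a k) (hβ : 0 ≤ β) (ha : 0 < a) {k' : ℝ}
    (h0 : 0 < k') (hlt : k' < k) :
    β * (k' * Real.sin (k' * a)) < Real.cos (k' * a) := by
  have hle := h.mul_le_pi_div_two hβ
  have hlt' : k' * a < k * a := mul_lt_mul_of_pos_right hlt ha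
  have hpos : 0 < k' * a := mul_pos h0 ha
  have hcos : Real.cos (k * a) < Real.cos (k' * a) :=
    Real.cos_lt_cos_of_nonneg_of_le_pi_div_two hpos.le hle hlt'
  have hsin : Real.sin (k' * a) ≤ Real.sin (k * a) :=
    Real.sin_le_sin_of_le_of_le_pi_div_two (by linarith [Real.pi_pos]) hle hlt'.le
  have hsin0 : 0 ≤ Real.sin (k' * a) :=
    Real.sin_nonneg_of_nonneg_of_le_pi hpos.le (by linarith [Real.pi_pos])
  rw [h.cos_eq] at hcos
  refine lt_of_le_of_lt (mul_le_mul_of_nonneg_left ?_ hβ) hcos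
  exact mul_le_mul hlt.le hsin hsin0 h.1.le

theorem log_eq (h : IsRobinFrequency β a k) :
    Real.log a = Real.log (Real.pi / 2 - Real.arctan (β * k)) - Real.log k := by
  have ha : a = (Real.pi / 2 - Real.arctan (β * k)) / k := by
    rw [← h.2, mul_div_cancel_left₀ _ h.1.ne']
  conv_lhs => rw [ha]
  rw [Real.log_div (pi_div_two_sub_arctan_pos _).ne' h.1.ne']

end IsRobinFrequency

/-- In the parametrization of `a` by `k = k(a)`, the function `robinSlope β` is
`-d log (k a) / d log k`, so that `d log a / d log k = -(1 + robinSlope β k)`. -/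
noncomputable def robinSlope (β k : ℝ) : ℝ :=
  β * k / ((1 + (β * k) ^ 2) * (Real.pi / 2 - Real.arctan (β * k)))

theorem robinSlope_nonneg {β k : ℝ} (hβ : 0 ≤ β) (hk : 0 ≤ k) : 0 ≤ robinSlope β k := by
  have := pi_div_two_sub_arctan_pos (β * k)
  unfold robinSlope
  positivity

/-- Strict monotonicity of `k ^ 2 / (1 + robinSlope β k)`; up to a factor, this is the strict
convexity of `k(a) ^ 2` as a function of `log a`. -/
theorem sq_mul_one_add_robinSlope_lt {β k l : ℝ} (hβ : 0 ≤ β) (hk : 0 < k) (hkl : k < l) :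
    k ^ 2 * (1 + robinSlope β l) < l ^ 2 * (1 + robinSlope β k) := by
  have hsq : k ^ 2 < l ^ 2 := by gcongr
  have hl : 0 < l := hk.trans hkl
  suffices k ^ 2 * robinSlope β l ≤ l ^ 2 * robinSlope β k by linarith
  have hTk := pi_div_two_sub_arctan_pos (β * k)
  have hTl := pi_div_two_sub_arctan_pos (β * l)
  have hβkl : β * k ≤ β * l := by gcongr
  have hβk : 0 ≤ β * k := by positivity
  have hmono : β * k * (Real.pi / 2 - Real.arctan (β * k)) ≤
      β * l * (Real.pi / 2 - Real.arctan (β * l)) := monotone_mul_pi_div_two_sub_arctan hβkl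
  have hmul : (1 + (β * k) ^ 2) * (β * k * (Real.pi / 2 - Real.arctan (β * k))) ≤
      (1 + (β * l) ^ 2) * (β * l * (Real.pi / 2 - Real.arctan (β * l))) :=
    mul_le_mul (by gcongr) hmono (by positivity) (by positivity)
  unfold robinSlope
  rw [mul_div_assoc', mul_div_assoc', div_le_div_iff₀ (by positivity) (by positivity)]
  have := mul_le_mul_of_nonneg_left hmul (mul_pos hk hl).le
  linarith

/-- The tangent-line inequality for `k(a) ^ 2` as a strictly convex function of `log a`, written in
terms of the frequencies. -/
theorem sq_add_log_lt {β p k : ℝ} (hβ : 0 ≤ β) (hp : 0 < p) (hk : 0 < k) (hne : k ≠ p) :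
    p ^ 2 + 2 * p ^ 2 / (1 + robinSlope β p) *
        (Real.log (Real.pi / 2 - Real.arctan (β * p)) - Real.log p) <
      k ^ 2 + 2 * p ^ 2 / (1 + robinSlope β p) *
        (Real.log (Real.pi / 2 - Real.arctan (β * k)) - Real.log k) := by
  -- `-c` is the slope `d (p ^ 2) / d log a` of the tangent line.
  set c := 2 * p ^ 2 / (1 + robinSlope β p) with hc
  have hSp : 0 < 1 + robinSlope β p := by linarith [robinSlope_nonneg hβ hp.le]
  have hcp : c * (1 + robinSlope β p) = 2 * p ^ 2 := by rw [hc]; field_simp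
  set H : ℝ → ℝ := fun q => q ^ 2 + c *
    (Real.log (Real.pi / 2 - Real.arctan (β * q)) - Real.log q) with hH
  have hd : ∀ q, 0 < q → HasDerivAt H ((2 * q ^ 2 - c * (1 + robinSlope β q)) / q) q := by
    intro q hq
    have hT := pi_div_two_sub_arctan_pos (β * q)
    have h1 : HasDerivAt (fun q => Real.pi / 2 - Real.arctan (β * q))
        (-(1 / (1 + (β * q) ^ 2) * (β * 1))) q :=
      ((hasDerivAt_id q).const_mul β).arctan.const_sub (Real.pi / 2)
    have h2 := ((hasDerivAt_pow 2 q).add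
      (((h1.log hT.ne').sub (Real.hasDerivAt_log hq.ne')).const_mul c))
    refine HasDerivAt.congr_deriv (f := H) h2 ?_
    unfold robinSlope
    have : 1 + (β * q) ^ 2 ≠ 0 := by positivity
    have := hT.ne'
    field_simp
    ring
  have hcpos : 0 < c := by positivity
  rcases lt_or_gt_of_ne hne with hlt | hgt
  · have hanti : StrictAntiOn H (Set.Icc k p) := by
      refine strictAntiOn_of_deriv_neg (convex_Icc k p)
        (fun q hq => (hd q (hk.trans_le hq.1)).continuousAt.continuousWithinAt) fun q hq => ?_
      rw [interior_Icc] at hq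
      have hq0 := hk.trans hq.1
      rw [(hd q hq0).deriv]
      refine div_neg_of_neg_of_pos ?_ hq0
      have h := sq_mul_one_add_robinSlope_lt hβ hq0 hq.2
      rw [hc, sub_neg, div_mul_eq_mul_div, lt_div_iff₀ hSp]
      linarith
    exact hanti ⟨le_rfl, hlt.le⟩ ⟨hlt.le, le_rfl⟩ hlt
  · have hmono : StrictMonoOn H (Set.Icc p k) := by
      refine strictMonoOn_of_deriv_pos (convex_Icc p k)
        (fun q hq => (hd q (hp.trans_le hq.1)).continuousAt.continuousWithinAt) fun q hq => ?_
      rw [interior_Icc] at hq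
      have hq0 := hp.trans hq.1
      rw [(hd q hq0).deriv]
      refine div_pos ?_ hq0
      have h := sq_mul_one_add_robinSlope_lt hβ hp hq.1
      rw [hc, sub_pos, div_mul_eq_mul_div, div_lt_iff₀ hSp]
      linarith
    exact hmono ⟨le_rfl, hgt.le⟩ ⟨hgt.le, le_rfl⟩ hgt

/-! ### The fundamental eigenvalue of a box -/

theorem isLeast_robinEigenvalues {N : ℕ} {β : ℝ} (hβ : 0 ≤ β) {a k : Fin N → ℝ}
    (ha : ∀ j, 0 < a j) (hk : ∀ j, IsRobinFrequency β (a j) (k j)) :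
    IsLeast (robinEigenvalues β a) (∑ j, k j ^ 2) := by
  refine ⟨⟨cosProd k, cosProd_isRobinEigenfunction ha fun j => (hk j).cos_eq⟩, ?_⟩
  rintro l ⟨u, hu⟩
  -- The frequencies `t kⱼ` with `t < 1` give strict supersolutions; let `t` tend to `1`.
  have hbound : ∀ t ∈ Set.Ioo (0 : ℝ) 1, t ^ 2 * ∑ j, k j ^ 2 ≤ l := by
    intro t ht
    have hlt (j : Fin N) : t * k j < k j := by nlinarith [ht.2, (hk j).1]
    have h := hu.sum_sq_le_of_supersolution hβ ha (k := fun j => t * k j)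
      (fun j => mul_pos ht.1 (hk j).1)
      (fun j => (mul_lt_mul_of_pos_right (hlt j) (ha j)).trans_le ((hk j).mul_le_pi_div_two hβ))
      (fun j => (hk j).supersolution hβ (ha j) (mul_pos ht.1 (hk j).1) (hlt j))
    simpa only [mul_pow, ← Finset.mul_sum] using h
  have hlim : Filter.Tendsto (fun t : ℝ => t ^ 2 * ∑ j, k j ^ 2) (nhdsWithin 1 (Set.Iio 1))
      (nhds (∑ j, k j ^ 2)) := by
    have hc : Continuous fun t : ℝ => t ^ 2 * ∑ j, k j ^ 2 := by fun_prop
    simpa using (hc.tendsto 1).mono_left nhdsWithin_le_nhds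
  refine le_of_tendsto hlim ?_
  filter_upwards [Ioo_mem_nhdsLT (zero_lt_one' ℝ)] with t ht using hbound t ht

theorem sum_log_eq_of_volume_box_eq {N : ℕ} {a : Fin N → ℝ} (ha : ∀ j, 0 < a j) {h : ℝ}
    (hh : 0 < h) (hvol : volume (box a) = volume (box fun _ : Fin N => h)) :
    ∑ j, Real.log (a j) = ∑ _j : Fin N, Real.log h := by
  rw [volume_box ha, volume_box fun _ => hh, ENNReal.ofReal_eq_ofReal_iff
    (Finset.prod_nonneg fun j _ => by linarith [ha j])
    (Finset.prod_nonneg fun j _ => by linarith), Finset.prod_mul_distrib,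
    Finset.prod_mul_distrib] at hvol
  have := mul_left_cancel₀ (Finset.prod_ne_zero_iff.2 fun _ _ => two_ne_zero) hvol
  rw [← Real.log_prod fun j _ => (ha j).ne', this, Real.log_prod fun _ _ => hh.ne']

theorem mainTheorem1 (N : ℕ) (hN : 1 ≤ N) (β : ℝ) (hβ : 0 ≤ β) :
    (∀ a : Fin N → ℝ, (∀ j, 0 < a j) →
      IsLeast (robinEigenvalues β a) (fundamentalRobinEigenvalue β a)) ∧
    (∀ a : Fin N → ℝ, (∀ j, 0 < a j) → ∀ h : ℝ, 0 < h →
      volume (box a) = volume (box (fun _ : Fin N => h)) →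
      fundamentalRobinEigenvalue β (fun _ : Fin N => h) ≤ fundamentalRobinEigenvalue β a ∧
      (fundamentalRobinEigenvalue β a = fundamentalRobinEigenvalue β (fun _ : Fin N => h) ↔
        ∀ j, a j = h)) := by
  refine ⟨fun a ha => ?_, fun a ha h hh hvol => ?_⟩
  · choose k hk using fun j => exists_isRobinFrequency hβ (ha j)
    have hl := isLeast_robinEigenvalues hβ ha hk
    rwa [fundamentalRobinEigenvalue, hl.csInf_eq]
  · choose k hk using fun j => exists_isRobinFrequency hβ (ha j)
    obtain ⟨p, hp⟩ := exists_isRobinFrequency hβ hh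
    have hla : fundamentalRobinEigenvalue β a = ∑ j, k j ^ 2 :=
      (isLeast_robinEigenvalues hβ ha hk).csInf_eq
    have hlh : fundamentalRobinEigenvalue β (fun _ : Fin N => h) = ∑ _j : Fin N, p ^ 2 :=
      (isLeast_robinEigenvalues hβ (fun _ => hh) fun _ => hp).csInf_eq
    set c := 2 * p ^ 2 / (1 + robinSlope β p)
    have hsum : ∑ j, c * Real.log (a j) = ∑ _j : Fin N, c * Real.log h := by
      rw [← Finset.mul_sum, ← Finset.mul_sum, sum_log_eq_of_volume_box_eq ha hh hvol]
    have hlt : ∀ j, k j ≠ p → p ^ 2 + c * Real.log h < k j ^ 2 + c * Real.log (a j) := by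
      intro j hj
      rw [hp.log_eq, (hk j).log_eq]
      exact sq_add_log_lt hβ hp.1 (hk j).1 hj
    have heq : ∀ j, k j = p → a j = h := by
      intro j hj
      have h1 := (hk j).2
      rw [hj, ← hp.2] at h1
      exact mul_left_cancel₀ hp.1.ne' h1
    have hle : ∀ j ∈ Finset.univ, p ^ 2 + c * Real.log h ≤ k j ^ 2 + c * Real.log (a j) := by
      intro j _
      by_cases hj : k j = p
      · rw [heq j hj, hj]
      · exact (hlt j hj).le
    refine ⟨?_, fun he => ?_, fun he => ?_⟩
    · have := Finset.sum_le_sum hle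
      rw [Finset.sum_add_distrib, Finset.sum_add_distrib] at this
      linarith
    · intro j
      refine heq j (by_contra fun hj => ?_)
      have := Finset.sum_lt_sum hle ⟨j, Finset.mem_univ j, hlt j hj⟩
      rw [Finset.sum_add_distrib, Finset.sum_add_distrib] at this
      linarith
    · rw [show a = fun _ => h from funext he]
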